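/- (a) Let $N\in\{0,1,2,\dots\}\cup\{\infty\}$ and let $\mu$ be a positive Borel measure on $\mathbb{R}$ with $\int|x|^m\,d\mu(x)<\infty$ for all integers $m\ge 0$, whose support has at least $N+1$ points (infinitely many if $N=\infty$). For integers $0\le n\le N$ (all $n\ge 0$ if $N=\infty$) let $p_n$ be a real polynomial of degree $n$ such that $\int p_m p_n\,d\mu=h_n\delta_{m,n}$. Put $K_n(x,y)=\sum_{k=0}^n p_k(x)p_k(y)/h_k$. Let $x_0\in\mathbb{R}$, let $c_n$ be real constants, and let $q_n(x)=c_nK_n(x_0,x)$. Then, for all integers $0\le n\le N$, $n<\infty$, the function $q_n^2$ is $\mu$-integrable and $$\int_{\mathbb{R}} q_n(x)^2\,d\mu(x)=c_n\,q_n(x_0).$$ (b) Let $\alpha,\beta>-1$, write $(a)_k=a(a+1)\cdots(a+k-1)$, and let $$P_n^{(\alpha,\beta)}(x)=\sum_{k=0}^n\frac{(n+\alpha+\beta+1)_k\,(\alpha+k+1)_{n-k}}{k!\,(n-k)!}\Big(\frac{x-1}{2}\Big)^k\qquad(n\ge 0)$$ be the Jacobi polynomials. Then $p_n=P_n^{(\alpha,\beta)}$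 ($n\ge 0$) are orthogonal polynomials as in (a), with $N=\infty$, for the measure $d\mu(x)=(1-x)^\alpha(1+x)^\beta\,dx$ on $[-1,1]$ and $h_n=\int p_n^2\,d\mu$. For every integer $n\ge 0$ we have $P_n^{(\alpha,\beta)}(1)=(\alpha+1)_n/n!$, and the kernel polynomials of (a) for $x_0=1$ and $$c_n=\frac{2^{\alpha+\beta+1}\,\Gamma(\alpha+1)\,\Gamma(n+\beta+1)}{\Gamma(n+\alpha+\beta+2)}$$ are $q_n=P_n^{(\alpha+1,\beta)}$. Moreover, the following integral converges absolutely and $$\int_{-1}^1 P_n^{(\alpha+1,\beta)}(x)^2\,(1-x)^\alpha(1+x)^\beta\,dx=\frac{2^{\alpha+\beta+1}}{\alpha+1}\,\frac{\Gamma(n+\alpha+2)\,\Gamma(n+\beta+1)}{\Gamma(n+\alpha+\beta+2)\,n!}.$$ -/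

import Mathlib

open MeasureTheory

noncomputable section

/-- The polynomials `p n`, for `n ≤ N` (all `n` if `N = ⊤`), are orthogonal polynomials with respect
to the positive Borel measure `μ` on the real line, with squared norms `h n`. The measure has finite
moments of all orders and its support has at least `N + 1` points (infinitely many if `N = ⊤`). -/
structure IsOrthogonalSystem (N : ℕ∞) (μ : Measure ℝ) (p : ℕ → Polynomial ℝ) (h : ℕ → ℝ) :
    Prop where
  moments : ∀ n : ℕ, Integrable (fun x : ℝ => |x| ^ n) μ
  support : N + 1 ≤ μ.support.encard
  degree : ∀ n : ℕ, (n : ℕ∞) ≤ N → (p n).degree = n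
  orthogonal : ∀ m n : ℕ, (m : ℕ∞) ≤ N → (n : ℕ∞) ≤ N →
    ∫ x, (p m).eval x * (p n).eval x ∂μ = if m = n then h n else 0

/-- The Christoffel–Darboux kernel `K_n(x, y) = ∑_{k=0}^n p_k(x) p_k(y) / h_k`. -/
def christoffelDarboux (p : ℕ → Polynomial ℝ) (h : ℕ → ℝ) (n : ℕ) (x y : ℝ) : ℝ :=
  ∑ k ∈ Finset.range (n + 1), (p k).eval x * (p k).eval y / h k

/-- The kernel polynomial `q_n(x) = c_n K_n(x₀, x)`. -/
def kernelPoly (p : ℕ → Polynomial ℝ) (h : ℕ → ℝ) (c : ℕ → ℝ) (x₀ : ℝ) (n : ℕ) (x : ℝ) : ℝ :=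
  c n * christoffelDarboux p h n x₀ x

/-- The Jacobi polynomial
`P_n^{(α,β)}(x) = ∑_{k=0}^n (n+α+β+1)_k (α+k+1)_{n-k} / (k! (n-k)!) ((x-1)/2)^k`, that is,
`((α+1)_n / n!) ₂F₁(-n, n+α+β+1; α+1; (1-x)/2)`. -/
def jacobiPoly (α β : ℝ) (n : ℕ) : Polynomial ℝ :=
  ∑ k ∈ Finset.range (n + 1),
    Polynomial.C ((ascPochhammer ℝ k).eval (n + α + β + 1) *
        (ascPochhammer ℝ (n - k)).eval (α + k + 1) / (k.factorial * (n - k).factorial)) *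
      (Polynomial.C (1 / 2) * (Polynomial.X - 1)) ^ k

/-- The measure `(1-x)^α (1+x)^β dx` on `[-1, 1]`. -/
def jacobiMeasure (α β : ℝ) : Measure ℝ :=
  (volume.restrict (Set.Icc (-1) 1)).withDensity
    (fun x => ENNReal.ofReal ((1 - x) ^ α * (1 + x) ^ β))

/-- The squared norm of the Jacobi polynomial `P_n^{(α,β)}`. -/
def jacobiNorm (α β : ℝ) (n : ℕ) : ℝ :=
  ∫ x, (jacobiPoly α β n).eval x ^ 2 ∂(jacobiMeasure α β)

/-- The constants `2^{α+β+1} Γ(α+1) Γ(n+β+1) / Γ(n+α+β+2)`. -/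
def jacobiConst (α β : ℝ) (n : ℕ) : ℝ :=
  2 ^ (α + β + 1) * Real.Gamma (α + 1) * Real.Gamma (n + β + 1) / Real.Gamma (n + α + β + 2)

end

/-! Expand `q_n = ∑ a_k p_k` with `a_k = c_n p_k(x₀) / h_k`. Orthogonality gives `∫ q_n² = ∑ a_k²
h_k = c_n ∑ a_k p_k(x₀) = c_n q_n(x₀)`; the `h_k` are nonzero because the support has more points
than `p_k` has roots.

For Jacobi polynomials, `q_n` is the only polynomial of degree at most `n` with `∫ q f dμ = c_n
f(x₀)` whenever `deg f ≤ n` (`eval_eq_kernelPoly`). To check this for `P_n^{(α+1,β)}` at `x₀ = 1`,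
write `f = f(1) ((1+x)/2)^n + (x-1) g` with `deg g < n`. The factor `1-x` turns the weight into that
of `(α+1, β)`, so the `g` term vanishes by orthogonality; the other term is a sum of beta integrals
(`integral_jacobiPoly_succ_mul`). Orthogonality itself is tested on powers of `1+x`, where it
becomes the vanishing of an `n`-th finite difference. Evaluating at `1` gives the norm. -/

open Polynomial in
theorem exists_eq_sum_of_degree_lt {K : Type*} [Field K] (p : ℕ → K[X]) :
    ∀ n : ℕ, (∀ k < n, (p k).degree = k) → ∀ f : K[X], f.degree < n →
      ∃ a : ℕ → K, f = ∑ k ∈ Finset.range n, C (a k) * p k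
  | 0, _, f, hf => ⟨0, by simpa [Polynomial.degree_lt_iff_coeff_zero, Polynomial.ext_iff] using hf⟩
  | n + 1, hp, f, hf => by
    have hdeg := hp n n.lt_succ_self
    have hcoeff : (p n).coeff n ≠ 0 := by
      have hnat : (p n).natDegree = n := natDegree_eq_of_degree_eq_some hdeg
      have : p n ≠ 0 := by rintro h; simp [h] at hdeg
      rwa [← leadingCoeff_ne_zero, leadingCoeff, hnat] at this
    -- The subtracted multiple of `p n` cancels the coefficient of `X ^ n`.
    obtain ⟨a, ha⟩ := exists_eq_sum_of_degree_lt p n (fun k hk => hp k (hk.trans n.lt_succ_self))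
      (f - C (f.coeff n / (p n).coeff n) * p n) (by
        rw [degree_lt_iff_coeff_zero] at hf ⊢
        intro m hm
        rcases hm.eq_or_lt with rfl | hm
        · simp [hcoeff]
        · have h1 : (p n).coeff m = 0 := coeff_eq_zero_of_degree_lt (by rw [hdeg]; exact_mod_cast hm)
          simp [h1, hf m hm])
    refine ⟨Function.update a n (f.coeff n / (p n).coeff n), ?_⟩
    rw [Finset.sum_range_succ, Function.update_self, Finset.sum_congr rfl (g := fun k => C (a k) * p k),
      ← ha, sub_add_cancel]
    intro k hk
    rw [Function.update_of_ne (Finset.mem_range.1 hk).ne]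

/-! ### Pochhammer symbols and alternating binomial sums -/

theorem ascPochhammer_eval_mul_Gamma {x : ℝ} (hx : 0 < x) (n : ℕ) :
    (ascPochhammer ℝ n).eval x * Real.Gamma x = Real.Gamma (x + n) := by
  induction n with
  | zero => simp
  | succ n ih =>
    rw [ascPochhammer_succ_eval, mul_right_comm, ih, Nat.cast_succ, ← add_assoc,
      Real.Gamma_add_one (by positivity), mul_comm]

/-- Up to the sign `(-1)^n`, this is the `n`-th forward difference of `P` at `0`. -/
theorem sum_neg_one_pow_mul_choose_mul_eval_eq_zero {P : Polynomial ℝ} {n : ℕ}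
    (hP : P.natDegree < n) :
    ∑ k ∈ Finset.range (n + 1), (-1 : ℝ) ^ k * n.choose k * P.eval (k : ℝ) = 0 := by
  have h := congrFun (Polynomial.fwdDiff_iter_eq_zero_of_degree_lt hP) 0
  rw [fwdDiff_iter_eq_sum_shift] at h
  have h2 : ∑ k ∈ Finset.range (n + 1), (-1 : ℝ) ^ (n - k) * n.choose k * P.eval (k : ℝ) = 0 := by
    simpa [zsmul_eq_mul] using h
  have h3 := congrArg (fun t => (-1 : ℝ) ^ n * t) h2
  simp only [mul_zero, Finset.mul_sum] at h3
  rw [← h3]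
  refine Finset.sum_congr rfl fun k hk => ?_
  obtain ⟨j, rfl⟩ := Nat.exists_eq_add_of_le (Nat.lt_succ_iff.1 (Finset.mem_range.1 hk))
  have : (-1 : ℝ) ^ (k + j) * (-1) ^ j = (-1) ^ k := by
    rw [pow_add, mul_assoc, ← mul_pow]; simp
  rw [Nat.add_sub_cancel_left, ← this]; ring

/-- Partial fractions of `n! / (a (a+1) ⋯ (a+n))`. By Pascal's rule the sums satisfy `S_{n+1}(a) =
S_n(a) - S_n(a+1)`. -/
theorem sum_neg_one_pow_mul_choose_div_add {n : ℕ} {a : ℝ} (ha : 0 < a) :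
    ∑ k ∈ Finset.range (n + 1), (-1 : ℝ) ^ k * n.choose k / (a + k) =
      n.factorial / (ascPochhammer ℝ (n + 1)).eval a := by
  induction n generalizing a with
  | zero => simp
  | succ n ih =>
    have hsplit : ∑ k ∈ Finset.range (n + 2), (-1 : ℝ) ^ k * (n + 1).choose k / (a + k) =
        ∑ k ∈ Finset.range (n + 1), (-1 : ℝ) ^ k * n.choose k / (a + k) -
        ∑ k ∈ Finset.range (n + 1), (-1 : ℝ) ^ k * n.choose k / (a + 1 + k) := by
      have h1 : ∑ k ∈ Finset.range (n + 1), (-1 : ℝ) ^ k * n.choose k / (a + k) =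
          ∑ k ∈ Finset.range (n + 2), (-1 : ℝ) ^ k * n.choose k / (a + k) := by
        rw [Finset.sum_range_succ _ (n + 1)]; simp
      rw [h1, Finset.sum_range_succ', Finset.sum_range_succ' _ (n + 1), add_sub_right_comm,
        ← Finset.sum_sub_distrib]
      congr 1
      · refine Finset.sum_congr rfl fun k _ => ?_
        rw [Nat.choose_succ_succ, pow_succ]; push_cast
        rw [add_right_comm a 1 (k : ℝ), ← add_assoc]; ring
      · simp
    have hpos := ascPochhammer_pos (S := ℝ) n (a + 1) (by positivity)
    have e1 : (ascPochhammer ℝ (n + 1)).eval a = a * (ascPochhammer ℝ n).eval (a + 1) := by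
      simp [ascPochhammer_succ_left]
    have e2 : (ascPochhammer ℝ (n + 1 + 1)).eval a =
        a * ((ascPochhammer ℝ n).eval (a + 1) * (a + 1 + n)) := by
      rw [ascPochhammer_succ_left, ← ascPochhammer_succ_eval]; simp
    have h3 : a + 1 + n ≠ 0 := by positivity
    rw [hsplit, ih ha, ih (by positivity), e1, e2, ascPochhammer_succ_eval, Nat.factorial_succ]
    field_simp
    push_cast; ring

/-! ### General orthogonal systems and kernel polynomials -/

theorem integrable_polynomial_eval {μ : Measure ℝ} (hμ : ∀ n : ℕ, Integrable (fun x : ℝ => |x| ^ n) μ)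
    (f : Polynomial ℝ) : Integrable (fun x => f.eval x) μ := by
  simp only [Polynomial.eval_eq_sum_range]
  refine integrable_finsetSum _ fun n _ => Integrable.const_mul ?_ _
  exact (hμ n).mono' (by fun_prop) (.of_forall fun x => by simp)

/-- If the integral were zero, `f` would vanish almost everywhere, hence on the whole support since
its zero set is closed; that is more roots than the degree allows. -/
theorem integral_polynomial_sq_pos {μ : Measure ℝ}
    (hμ : ∀ n : ℕ, Integrable (fun x : ℝ => |x| ^ n) μ) {f : Polynomial ℝ} (hf : f ≠ 0)
    (hsupp : f.natDegree < μ.support.encard) : 0 < ∫ x, f.eval x * f.eval x ∂μ := by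
  have hnonneg : 0 ≤ fun x => f.eval x * f.eval x := fun x => mul_self_nonneg _
  refine (integral_nonneg hnonneg).lt_of_ne fun h0 => ?_
  have hint : Integrable (fun x => f.eval x * f.eval x) μ := by
    simpa using integrable_polynomial_eval hμ (f * f)
  have hae := (integral_eq_zero_iff_of_nonneg hnonneg hint).1 h0.symm
  have hsub : μ.support ⊆ {x | f.eval x = 0} := by
    refine Measure.support_subset_of_isClosed (isClosed_eq f.continuous continuous_const) ?_
    filter_upwards [hae] with x hx
    simpa using hx
  have hcard : μ.support.encard ≤ f.natDegree := by
    calc μ.support.encard ≤ (f.roots.toFinset : Set ℝ).encard :=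
          Set.encard_le_encard fun x hx => by simpa [hf] using hsub hx
      _ = f.roots.toFinset.card := Set.encard_coe_eq_coe_finsetCard _
      _ ≤ f.natDegree := by
        exact_mod_cast (Multiset.toFinset_card_le _).trans f.card_roots'
  exact absurd hsupp hcard.not_gt

namespace IsOrthogonalSystem

variable {N : ℕ∞} {μ : Measure ℝ} {p : ℕ → Polynomial ℝ} {h : ℕ → ℝ}

theorem norm_pos (H : IsOrthogonalSystem N μ p h) {n : ℕ} (hn : (n : ℕ∞) ≤ N) : 0 < h n := by
  have hdeg := H.degree n hn
  have horth := H.orthogonal n n hn hn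
  rw [if_pos rfl] at horth
  rw [← horth]
  refine integral_polynomial_sq_pos H.moments (by rintro h0; simp [h0] at hdeg) ?_
  rw [Polynomial.natDegree_eq_of_degree_eq_some hdeg]
  exact ((ENat.lt_add_one_iff (ENat.natCast_ne_top n)).2 le_rfl).trans_le
    ((by gcongr : (n : ℕ∞) + 1 ≤ N + 1).trans H.support)

theorem integral_sum_mul (H : IsOrthogonalSystem N μ p h) {n k : ℕ} (hn : (n : ℕ∞) ≤ N)
    (hk : k ≤ n) (a : ℕ → ℝ) :
    ∫ x, (∑ j ∈ Finset.range (n + 1), a j * (p j).eval x) * (p k).eval x ∂μ = a k * h k := by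
  have hN : ∀ j ≤ n, (j : ℕ∞) ≤ N := fun j hj => le_trans (by exact_mod_cast hj) hn
  simp only [Finset.sum_mul, mul_assoc]
  rw [integral_finsetSum]
  · rw [Finset.sum_eq_single k]
    · rw [integral_const_mul, H.orthogonal k k (hN k hk) (hN k hk), if_pos rfl]
    · intro j hj hjk
      rw [integral_const_mul, H.orthogonal j k (hN j (by simpa [Nat.lt_succ_iff] using hj)) (hN k hk),
        if_neg hjk, mul_zero]
    · intro hk'
      exact absurd (Finset.mem_range.2 (Nat.lt_succ_of_le hk)) hk'
  · intro j _
    simpa using (integrable_polynomial_eval H.moments (p j * p k)).const_mul (a j)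

theorem integrable_kernelPoly_sq (H : IsOrthogonalSystem N μ p h) (x₀ : ℝ) (c : ℕ → ℝ) (n : ℕ) :
    Integrable (fun x => kernelPoly p h c x₀ n x ^ 2) μ := by
  have := integrable_polynomial_eval H.moments
    ((Polynomial.C (c n) * ∑ k ∈ Finset.range (n + 1),
      Polynomial.C ((p k).eval x₀ / h k) * p k) ^ 2)
  refine this.congr (.of_forall fun x => ?_)
  simp [kernelPoly, christoffelDarboux, Polynomial.eval_finsetSum, div_mul_eq_mul_div]

theorem integral_kernelPoly_sq (H : IsOrthogonalSystem N μ p h) (x₀ : ℝ) (c : ℕ → ℝ) {n : ℕ}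
    (hn : (n : ℕ∞) ≤ N) :
    ∫ x, kernelPoly p h c x₀ n x ^ 2 ∂μ = c n * kernelPoly p h c x₀ n x₀ := by
  set a : ℕ → ℝ := fun k => c n * ((p k).eval x₀ / h k) with ha
  have hK : ∀ x, kernelPoly p h c x₀ n x = ∑ j ∈ Finset.range (n + 1), a j * (p j).eval x := by
    intro x
    rw [kernelPoly, christoffelDarboux, Finset.mul_sum]
    exact Finset.sum_congr rfl fun k _ => by rw [ha]; ring
  -- Only one of the two factors is expanded, so that `integral_sum_mul` evaluates each term.
  have hsq : ∀ x, kernelPoly p h c x₀ n x ^ 2 = ∑ k ∈ Finset.range (n + 1),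
      a k * ((∑ j ∈ Finset.range (n + 1), a j * (p j).eval x) * (p k).eval x) := by
    intro x
    rw [sq, hK x, Finset.mul_sum]
    exact Finset.sum_congr rfl fun k _ => by ring
  simp only [hsq]
  rw [integral_finsetSum, hK x₀, Finset.mul_sum]
  · refine Finset.sum_congr rfl fun k hk => ?_
    have hkn : k ≤ n := Nat.lt_succ_iff.1 (Finset.mem_range.1 hk)
    have hpos := H.norm_pos (le_trans (by exact_mod_cast hkn) hn : (k : ℕ∞) ≤ N)
    rw [integral_const_mul, H.integral_sum_mul hn hkn, ha]
    field_simp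
  · intro k _
    have := (integrable_polynomial_eval H.moments
      ((∑ j ∈ Finset.range (n + 1), Polynomial.C (a j) * p j) * p k)).const_mul (a k)
    simpa [Polynomial.eval_finsetSum] using this

/-- Testing the reproducing property on `p k` determines the `k`-th coefficient of `q`. -/
theorem eval_eq_kernelPoly (H : IsOrthogonalSystem N μ p h) (x₀ : ℝ) (c : ℕ → ℝ) {n : ℕ}
    (hn : (n : ℕ∞) ≤ N) {q : Polynomial ℝ} (hq : q.degree ≤ n)
    (hrep : ∀ f : Polynomial ℝ, f.degree ≤ n → ∫ x, q.eval x * f.eval x ∂μ = c n * f.eval x₀)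
    (x : ℝ) : q.eval x = kernelPoly p h c x₀ n x := by
  have hN : ∀ k ≤ n, (k : ℕ∞) ≤ N := fun k hk => le_trans (by exact_mod_cast hk) hn
  obtain ⟨a, ha⟩ := exists_eq_sum_of_degree_lt p (n + 1)
    (fun k hk => H.degree k (hN k (Nat.lt_succ_iff.1 hk))) q
    (hq.trans_lt (by exact_mod_cast n.lt_succ_self))
  have heval : ∀ y, q.eval y = ∑ j ∈ Finset.range (n + 1), a j * (p j).eval y := fun y => by
    rw [ha]; simp [Polynomial.eval_finsetSum]
  rw [heval, kernelPoly, christoffelDarboux, Finset.mul_sum]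
  refine Finset.sum_congr rfl fun k hk => ?_
  have hkn : k ≤ n := Nat.lt_succ_iff.1 (Finset.mem_range.1 hk)
  have hpos := H.norm_pos (hN k hkn)
  have h1 := hrep (p k) (by rw [H.degree k (hN k hkn)]; exact_mod_cast hkn)
  simp only [heval] at h1
  rw [H.integral_sum_mul hn hkn] at h1
  rw [eq_div_of_mul_eq hpos.ne' h1]
  ring

end IsOrthogonalSystem

/-! ### The Jacobi weight and its beta integrals -/

theorem intervalIntegrable_one_sub_rpow_mul_one_add_rpow {α β : ℝ} (hα : -1 < α) (hβ : -1 < β) :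
    IntervalIntegrable (fun x : ℝ => (1 - x) ^ α * (1 + x) ^ β) volume (-1) 1 := by
  -- On the left half only `1 + x` can vanish; the reflection `x ↦ -x` handles the right half.
  have hbase : ∀ a b : ℝ, -1 < b →
      IntervalIntegrable (fun x : ℝ => (1 - x) ^ a * (1 + x) ^ b) volume (-1) 0 := by
    intro a b hb
    refine IntervalIntegrable.continuousOn_mul (g := fun x : ℝ => (1 - x) ^ a) ?_ ?_
    · have := (intervalIntegral.intervalIntegrable_rpow' (a := 0) (b := 1) hb).comp_add_right 1
      simpa [add_comm] using this
    · refine ContinuousOn.rpow_const (by fun_prop) fun x hx => Or.inl ?_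
      rw [Set.uIcc_of_le (by norm_num)] at hx
      linarith [hx.2]
  refine (hbase α β hβ).trans ?_
  rw [IntervalIntegrable.iff_comp_neg]
  have := (hbase β α hα).symm
  simpa [mul_comm, sub_eq_add_neg] using this

theorem integral_one_sub_rpow_mul_one_add_rpow {α β : ℝ} (hα : -1 < α) (hβ : -1 < β) :
    ∫ x in (-1 : ℝ)..1, (1 - x) ^ α * (1 + x) ^ β =
      2 ^ (α + β + 1) * Real.Gamma (α + 1) * Real.Gamma (β + 1) / Real.Gamma (α + β + 2) := by
  have h2 := Complex.betaIntegral_scaled (β + 1 : ℝ) (α + 1 : ℝ) (a := 2) (by norm_num)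
  rw [Complex.betaIntegral_eq_Gamma_mul_div _ _ (by simpa using by linarith) (by simpa using by linarith),
    ← Complex.ofReal_add, Complex.Gamma_ofReal, Complex.Gamma_ofReal, Complex.Gamma_ofReal] at h2
  have h3 : ∫ x in (0 : ℝ)..2, (x : ℂ) ^ (((β + 1 : ℝ) : ℂ) - 1) *
        (((2 : ℝ) : ℂ) - x) ^ (((α + 1 : ℝ) : ℂ) - 1) =
      ((∫ x in (0 : ℝ)..2, x ^ β * (2 - x) ^ α : ℝ) : ℂ) := by
    rw [← intervalIntegral.integral_ofReal]
    refine intervalIntegral.integral_congr fun x hx => ?_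
    rw [Set.uIcc_of_le (by norm_num)] at hx
    have h2x : 0 ≤ 2 - x := by linarith [hx.2]
    rw [Complex.ofReal_mul, Complex.ofReal_cpow hx.1, Complex.ofReal_cpow h2x]
    push_cast
    simp
  have h4 : (((2 : ℝ) : ℂ)) ^ (((β + 1 + (α + 1) : ℝ) : ℂ) - 1) =
      (((2 : ℝ) ^ (α + β + 1) : ℝ) : ℂ) := by
    rw [Complex.ofReal_cpow (by norm_num)]
    congr 1; push_cast; ring
  rw [h3, h4] at h2
  have h5 : ∫ x in (-1 : ℝ)..1, (1 - x) ^ α * (1 + x) ^ β =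
      ∫ x in (0 : ℝ)..2, x ^ β * (2 - x) ^ α := by
    have := intervalIntegral.integral_comp_add_right (a := -1) (b := 1)
      (fun x : ℝ => x ^ β * (2 - x) ^ α) 1
    norm_num at this
    rw [← this]
    refine intervalIntegral.integral_congr fun x _ => ?_
    rw [show 2 - (x + 1) = 1 - x by ring, add_comm x 1, mul_comm]
  rw [h5]
  have h6 : (∫ x in (0 : ℝ)..2, x ^ β * (2 - x) ^ α) = 2 ^ (α + β + 1) *
      (Real.Gamma (β + 1) * Real.Gamma (α + 1) / Real.Gamma (β + 1 + (α + 1))) := by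
    exact_mod_cast h2
  rw [h6, show β + 1 + (α + 1) = α + β + 2 by ring]
  ring

theorem measurable_one_sub_rpow_mul_one_add_rpow (α β : ℝ) :
    Measurable fun x : ℝ => ENNReal.ofReal ((1 - x) ^ α * (1 + x) ^ β) := by
  fun_prop

theorem one_sub_rpow_mul_one_add_rpow_nonneg (α β : ℝ) {x : ℝ} (hx : x ∈ Set.Icc (-1 : ℝ) 1) :
    0 ≤ (1 - x) ^ α * (1 + x) ^ β :=
  mul_nonneg (Real.rpow_nonneg (by linarith [hx.2]) _) (Real.rpow_nonneg (by linarith [hx.1]) _)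

theorem integrable_jacobiMeasure_iff {α β : ℝ} {f : ℝ → ℝ} :
    Integrable f (jacobiMeasure α β) ↔
      IntervalIntegrable (fun x => (1 - x) ^ α * (1 + x) ^ β * f x) volume (-1) 1 := by
  rw [jacobiMeasure, integrable_withDensity_iff_integrable_smul'
    (measurable_one_sub_rpow_mul_one_add_rpow α β) (.of_forall fun _ => ENNReal.ofReal_lt_top),
    intervalIntegrable_iff_integrableOn_Icc_of_le (by norm_num), IntegrableOn]
  refine integrable_congr ((ae_restrict_iff' measurableSet_Icc).2 (.of_forall fun x hx => ?_))
  simp only [smul_eq_mul]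
  rw [ENNReal.toReal_ofReal (one_sub_rpow_mul_one_add_rpow_nonneg α β hx)]

theorem integral_jacobiMeasure (α β : ℝ) (f : ℝ → ℝ) :
    ∫ x, f x ∂(jacobiMeasure α β) =
      ∫ x in (-1 : ℝ)..1, (1 - x) ^ α * (1 + x) ^ β * f x := by
  rw [jacobiMeasure, integral_withDensity_eq_integral_toReal_smul
    (measurable_one_sub_rpow_mul_one_add_rpow α β) (.of_forall fun _ => ENNReal.ofReal_lt_top),
    intervalIntegral.integral_of_le (by norm_num), ← integral_Icc_eq_integral_Ioc]
  refine setIntegral_congr_fun measurableSet_Icc fun x hx => ?_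
  simp only [smul_eq_mul]
  rw [ENNReal.toReal_ofReal (one_sub_rpow_mul_one_add_rpow_nonneg α β hx)]

theorem integrable_jacobiMeasure_of_continuous {α β : ℝ} (hα : -1 < α) (hβ : -1 < β) {f : ℝ → ℝ}
    (hf : Continuous f) : Integrable f (jacobiMeasure α β) :=
  integrable_jacobiMeasure_iff.2 <|
    (intervalIntegrable_one_sub_rpow_mul_one_add_rpow hα hβ).mul_continuousOn hf.continuousOn

theorem integral_jacobiMeasure_one_sub_pow_mul_one_add_pow {α β : ℝ} (hα : -1 < α) (hβ : -1 < β)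
    (k m : ℕ) :
    ∫ x, (1 - x) ^ k * (1 + x) ^ m ∂(jacobiMeasure α β) =
      2 ^ (α + β + k + m + 1) * Real.Gamma (α + k + 1) * Real.Gamma (β + m + 1) /
        Real.Gamma (α + β + k + m + 2) := by
  have hk : (0 : ℝ) ≤ k := k.cast_nonneg
  have hm : (0 : ℝ) ≤ m := m.cast_nonneg
  have h := integral_one_sub_rpow_mul_one_add_rpow (α := α + k) (β := β + m)
    (by linarith) (by linarith)
  rw [show α + k + (β + m) + 1 = α + β + k + m + 1 by ring,
    show α + k + (β + m) + 2 = α + β + k + m + 2 by ring] at h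
  -- The endpoints are discarded because splitting the exponents needs nonzero bases.
  rw [← h, integral_jacobiMeasure, intervalIntegral.integral_of_le (by norm_num),
    intervalIntegral.integral_of_le (by norm_num), integral_Ioc_eq_integral_Ioo,
    integral_Ioc_eq_integral_Ioo]
  refine setIntegral_congr_fun measurableSet_Ioo fun x hx => ?_
  rw [Real.rpow_add_natCast (by linarith [hx.2]), Real.rpow_add_natCast (by linarith [hx.1])]
  ring

theorem integral_jacobiMeasure_one_sub_mul (α β : ℝ) (f : ℝ → ℝ) :
    ∫ x, (1 - x) * f x ∂(jacobiMeasure α β) = ∫ x, f x ∂(jacobiMeasure (α + 1) β) := by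
  rw [integral_jacobiMeasure, integral_jacobiMeasure, intervalIntegral.integral_of_le (by norm_num),
    intervalIntegral.integral_of_le (by norm_num), integral_Ioc_eq_integral_Ioo,
    integral_Ioc_eq_integral_Ioo]
  refine setIntegral_congr_fun measurableSet_Ioo fun x hx => ?_
  rw [Real.rpow_add_one (by linarith [hx.2])]
  ring

/-- A finite support is Lebesgue-null, which would make the measure zero, but its total mass is
positive. -/
theorem infinite_support_jacobiMeasure {α β : ℝ} (hα : -1 < α) (hβ : -1 < β) :
    (jacobiMeasure α β).support.Infinite := by
  intro hfin
  have hac : jacobiMeasure α β ≪ volume :=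
    (withDensity_absolutelyContinuous _ _).trans Measure.absolutelyContinuous_restrict
  have hzero : jacobiMeasure α β = 0 := by
    rw [← Measure.measure_univ_eq_zero, ← Set.union_compl_self (jacobiMeasure α β).support]
    exact measure_union_null (hac (hfin.measure_zero _)) Measure.measure_compl_support
  have h := integral_jacobiMeasure_one_sub_pow_mul_one_add_pow hα hβ 0 0
  rw [hzero] at h
  have h1 := Real.Gamma_pos_of_pos (s := α + 1) (by linarith)
  have h2 := Real.Gamma_pos_of_pos (s := β + 1) (by linarith)
  have h3 := Real.Gamma_pos_of_pos (s := α + β + 2) (by linarith)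
  simp only [integral_zero_measure, Nat.cast_zero, add_zero] at h
  exact (by positivity : (0 : ℝ) ≠ _) h

/-! ### Jacobi polynomials: degree, orthogonality, reproducing property -/

theorem degree_C_mul_le_degree {R : Type*} [Semiring R] (a : R) (f : Polynomial R) :
    (Polynomial.C a * f).degree ≤ f.degree := by
  rw [Polynomial.C_mul']
  exact Polynomial.degree_smul_le a f

open Polynomial in
theorem degree_C_half_mul_X_sub_one_pow (k : ℕ) :
    ((C (1 / 2 : ℝ) * (X - 1)) ^ k).degree = (k : WithBot ℕ) := by
  have h : (C (1 / 2 : ℝ) * (X - 1)).degree = 1 := by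
    rw [degree_C_mul (by norm_num), ← C_1, degree_X_sub_C]
  rw [degree_pow, h]; simp

theorem degree_jacobiPoly_le (α β : ℝ) (n : ℕ) : (jacobiPoly α β n).degree ≤ n := by
  refine (Polynomial.degree_sum_le _ _).trans (Finset.sup_le fun k hk => ?_)
  refine (degree_C_mul_le_degree _ _).trans ?_
  rw [degree_C_half_mul_X_sub_one_pow]
  exact_mod_cast Nat.lt_succ_iff.1 (Finset.mem_range.1 hk)

theorem degree_jacobiPoly {α β : ℝ} (hα : -1 < α) (hβ : -1 < β) (n : ℕ) :
    (jacobiPoly α β n).degree = n := by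
  have hlead : (ascPochhammer ℝ n).eval (n + α + β + 1) ≠ 0 := by
    -- For `n = 0` the argument `α + β + 1` may be nonpositive, but the empty product is `1`.
    rcases n with _ | n
    · simp
    · refine (ascPochhammer_pos _ _ ?_).ne'
      have : (0 : ℝ) ≤ n := n.cast_nonneg
      push_cast
      linarith
  rw [jacobiPoly, Finset.sum_range_succ, Polynomial.degree_add_eq_right_of_degree_lt] <;>
    rw [Polynomial.degree_C_mul (by simp [hlead, Nat.factorial_ne_zero]),
      degree_C_half_mul_X_sub_one_pow]
  refine (Polynomial.degree_sum_le _ _).trans_lt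
    ((Finset.sup_lt_iff (WithBot.bot_lt_coe n)).2 fun k hk => ?_)
  refine (degree_C_mul_le_degree _ _).trans_lt ?_
  rw [degree_C_half_mul_X_sub_one_pow]
  exact WithBot.coe_lt_coe.2 (Finset.mem_range.1 hk)

theorem jacobiPoly_eval_one (α β : ℝ) (n : ℕ) :
    (jacobiPoly α β n).eval 1 = (ascPochhammer ℝ n).eval (α + 1) / n.factorial := by
  rw [jacobiPoly, Polynomial.eval_finsetSum, Finset.sum_range_succ']
  simp

theorem integral_sum_mul_one_add_pow_jacobiMeasure {α β : ℝ} (hα : -1 < α) (hβ : -1 < β)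
    (a : ℕ → ℝ) (n m : ℕ) :
    ∫ x, (∑ k ∈ Finset.range (n + 1), Polynomial.C (a k) *
        (Polynomial.C (1 / 2) * (Polynomial.X - 1)) ^ k : Polynomial ℝ).eval x * (1 + x) ^ m
        ∂(jacobiMeasure α β) =
      2 ^ (α + β + m + 1) * Real.Gamma (β + m + 1) * ∑ k ∈ Finset.range (n + 1),
        (-1) ^ k * a k * Real.Gamma (α + k + 1) / Real.Gamma (α + β + k + m + 2) := by
  have hfun : ∀ x : ℝ, (∑ k ∈ Finset.range (n + 1), Polynomial.C (a k) *
        (Polynomial.C (1 / 2) * (Polynomial.X - 1)) ^ k : Polynomial ℝ).eval x * (1 + x) ^ m =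
      ∑ k ∈ Finset.range (n + 1), (a k * (-1 / 2) ^ k) * ((1 - x) ^ k * (1 + x) ^ m) := by
    intro x
    rw [Polynomial.eval_finsetSum, Finset.sum_mul]
    refine Finset.sum_congr rfl fun k _ => ?_
    have : (1 / 2 * (x - 1)) ^ k = (-1 / 2) ^ k * (1 - x) ^ k := by rw [← mul_pow]; ring
    simp only [Polynomial.eval_mul, Polynomial.eval_pow, Polynomial.eval_C, Polynomial.eval_sub,
      Polynomial.eval_X, Polynomial.eval_one, this]
    ring
  simp only [hfun]
  rw [integral_finsetSum, Finset.mul_sum]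
  · refine Finset.sum_congr rfl fun k _ => ?_
    rw [integral_const_mul, integral_jacobiMeasure_one_sub_pow_mul_one_add_pow hα hβ]
    have h2 : (2 : ℝ) ^ (α + β + k + m + 1) = 2 ^ k * 2 ^ (α + β + m + 1) := by
      rw [show α + β + k + m + 1 = (α + β + m + 1) + k by ring,
        Real.rpow_add_natCast (by norm_num), mul_comm]
    rw [h2, div_pow]
    field_simp
  · intro k _
    exact integrable_jacobiMeasure_of_continuous hα hβ (by fun_prop)

theorem integral_jacobiPoly_mul_one_add_pow_eq_zero {α β : ℝ} (hα : -1 < α) (hβ : -1 < β)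
    {n m : ℕ} (hmn : m < n) :
    ∫ x, (jacobiPoly α β n).eval x * (1 + x) ^ m ∂(jacobiMeasure α β) = 0 := by
  obtain ⟨r, rfl⟩ := Nat.exists_eq_add_of_lt hmn
  set n := m + r + 1 with hn
  have hnR : (n : ℝ) = m + r + 1 := by rw [hn]; push_cast; ring
  have hm0 : (0 : ℝ) ≤ m := m.cast_nonneg
  have hr0 : (0 : ℝ) ≤ r := r.cast_nonneg
  rw [jacobiPoly, integral_sum_mul_one_add_pow_jacobiMeasure hα hβ]
  -- `P(k)` is the ratio `Γ(n+α+β+1+k) / Γ(α+β+k+m+2)`, a polynomial in `k` of degree `r = n-m-1`.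
  set P : Polynomial ℝ :=
    (ascPochhammer ℝ r).comp (Polynomial.X + Polynomial.C (α + β + m + 2)) with hP
  have hPdeg : P.natDegree < n := by
    rw [hP, Polynomial.natDegree_comp, ascPochhammer_natDegree, Polynomial.natDegree_X_add_C]
    omega
  have hterm : ∀ k ∈ Finset.range (n + 1),
      (-1) ^ k * ((ascPochhammer ℝ k).eval (n + α + β + 1) *
        (ascPochhammer ℝ (n - k)).eval (α + k + 1) / (k.factorial * (n - k).factorial)) *
        Real.Gamma (α + k + 1) / Real.Gamma (α + β + k + m + 2) =
      Real.Gamma (α + n + 1) / (n.factorial * Real.Gamma (n + α + β + 1)) *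
        ((-1) ^ k * n.choose k * P.eval (k : ℝ)) := by
    intro k hk
    have hkn : k ≤ n := Nat.lt_succ_iff.1 (Finset.mem_range.1 hk)
    have hk0 : (0 : ℝ) ≤ k := k.cast_nonneg
    have e1 := ascPochhammer_eval_mul_Gamma (x := α + k + 1) (by linarith) (n - k)
    have e2 := ascPochhammer_eval_mul_Gamma (x := n + α + β + 1) (by linarith) k
    have e3 := ascPochhammer_eval_mul_Gamma (x := α + β + k + m + 2) (by linarith) r
    have hg2 := (Real.Gamma_pos_of_pos (s := n + α + β + 1) (by linarith)).ne'
    have hg3 := (Real.Gamma_pos_of_pos (s := α + β + k + m + 2) (by linarith)).ne'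
    have hPk : P.eval (k : ℝ) = (ascPochhammer ℝ r).eval (α + β + k + m + 2) := by
      rw [hP, Polynomial.eval_comp]
      congr 1
      simp; ring
    rw [show α + k + 1 + ((n - k : ℕ) : ℝ) = α + n + 1 by push_cast [hkn]; ring] at e1
    rw [show (α + β + k + m + 2 + r : ℝ) = n + α + β + 1 + k by rw [hnR]; ring, ← e2,
      ← eq_div_iff hg3] at e3
    rw [hPk, e3, ← e1, Nat.cast_choose ℝ hkn]
    have := n.factorial_ne_zero
    field_simp
  rw [Finset.sum_congr rfl hterm, ← Finset.mul_sum,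
    sum_neg_one_pow_mul_choose_mul_eval_eq_zero hPdeg, mul_zero, mul_zero]

theorem integral_jacobiPoly_succ_mul_one_add_pow {α β : ℝ} (hα : -1 < α) (hβ : -1 < β) (n : ℕ) :
    ∫ x, (jacobiPoly (α + 1) β n).eval x * (1 + x) ^ n ∂(jacobiMeasure α β) =
      jacobiConst α β n * 2 ^ n := by
  have hn0 : (0 : ℝ) ≤ n := n.cast_nonneg
  rw [jacobiPoly, integral_sum_mul_one_add_pow_jacobiMeasure hα hβ]
  have hG := (Real.Gamma_pos_of_pos (s := n + α + β + 2) (by linarith)).ne'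
  -- Here the Gamma factors in `α+β` leave a constant, while `Γ(α+k+1) / Γ(α+k+2)` leaves the simple
  -- fraction `1 / (α+1+k)`.
  have hterm : ∀ k ∈ Finset.range (n + 1),
      (-1) ^ k * ((ascPochhammer ℝ k).eval (n + (α + 1) + β + 1) *
        (ascPochhammer ℝ (n - k)).eval (α + 1 + k + 1) / (k.factorial * (n - k).factorial)) *
        Real.Gamma (α + k + 1) / Real.Gamma (α + β + k + n + 2) =
      Real.Gamma (α + n + 2) / (n.factorial * Real.Gamma (n + α + β + 2)) *
        ((-1) ^ k * n.choose k / (α + 1 + k)) := by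
    intro k hk
    have hkn : k ≤ n := Nat.lt_succ_iff.1 (Finset.mem_range.1 hk)
    have hk0 : (0 : ℝ) ≤ k := k.cast_nonneg
    have hak : α + k + 1 ≠ 0 := by linarith
    have e0 := Real.Gamma_add_one hak
    have e1 := ascPochhammer_eval_mul_Gamma (x := α + 1 + k + 1) (by linarith) (n - k)
    have e2 := ascPochhammer_eval_mul_Gamma (x := n + α + β + 2) (by linarith) k
    have hg3 := (Real.Gamma_pos_of_pos (s := α + β + k + n + 2) (by linarith)).ne'
    rw [show α + 1 + k + 1 + ((n - k : ℕ) : ℝ) = α + n + 2 by push_cast [hkn]; ring,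
      show α + 1 + k + 1 = α + k + 1 + 1 by ring, e0] at e1
    rw [show (n + α + β + 2 + k : ℝ) = α + β + k + n + 2 by ring] at e2
    rw [show (n + (α + 1) + β + 1 : ℝ) = n + α + β + 2 by ring,
      show α + 1 + k + 1 = α + k + 1 + 1 by ring, show α + 1 + (k : ℝ) = α + k + 1 by ring, ← e1,
      ← e2, Nat.cast_choose ℝ hkn]
    rw [← e2] at hg3
    have hP := left_ne_zero_of_mul hg3
    have := n.factorial_ne_zero
    field_simp
  have hα0 : 0 < α + 1 := by linarith
  have e := ascPochhammer_eval_mul_Gamma hα0 (n + 1)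
  rw [show α + 1 + ((n + 1 : ℕ) : ℝ) = α + n + 2 by push_cast; ring] at e
  have hP := (ascPochhammer_pos (n + 1) _ hα0).ne'
  have h2 : (2 : ℝ) ^ (α + β + n + 1) = 2 ^ (α + β + 1) * 2 ^ n := by
    rw [show α + β + n + 1 = (α + β + 1) + n by ring, Real.rpow_add_natCast (by norm_num)]
  have := n.factorial_ne_zero
  rw [Finset.sum_congr rfl hterm, ← Finset.mul_sum, sum_neg_one_pow_mul_choose_div_add hα0, ← e,
    jacobiConst, h2, show β + n + 1 = n + β + 1 by ring]
  field_simp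

theorem integral_jacobiPoly_mul_eq_zero {α β : ℝ} (hα : -1 < α) (hβ : -1 < β) {n : ℕ}
    {f : Polynomial ℝ} (hf : f.degree < n) :
    ∫ x, (jacobiPoly α β n).eval x * f.eval x ∂(jacobiMeasure α β) = 0 := by
  obtain ⟨a, rfl⟩ := exists_eq_sum_of_degree_lt (fun k => (Polynomial.X + Polynomial.C (1 : ℝ)) ^ k) n
    (fun k _ => by rw [Polynomial.degree_pow, Polynomial.degree_X_add_C]; simp) f hf
  simp only [Polynomial.eval_finsetSum, Finset.mul_sum]
  rw [integral_finsetSum]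
  · refine Finset.sum_eq_zero fun k hk => ?_
    have h := integral_jacobiPoly_mul_one_add_pow_eq_zero hα hβ (Finset.mem_range.1 hk)
    simp only [Polynomial.eval_mul, Polynomial.eval_pow, Polynomial.eval_C, Polynomial.eval_add,
      Polynomial.eval_X, mul_left_comm _ (a k), add_comm _ (1 : ℝ)]
    rw [integral_const_mul, h, mul_zero]
  · intro k _
    exact integrable_jacobiMeasure_of_continuous hα hβ (by fun_prop)

theorem integral_jacobiPoly_succ_mul {α β : ℝ} (hα : -1 < α) (hβ : -1 < β) {n : ℕ}
    {f : Polynomial ℝ} (hf : f.degree ≤ n) :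
    ∫ x, (jacobiPoly (α + 1) β n).eval x * f.eval x ∂(jacobiMeasure α β) =
      jacobiConst α β n * f.eval 1 := by
  -- This `b` makes `b (1+x)^n` agree with `f` at `1`.
  set b : ℝ := f.eval 1 / 2 ^ n with hb
  set e : Polynomial ℝ := Polynomial.C b * (Polynomial.X + Polynomial.C 1) ^ n with he
  have hroot : (f - e).IsRoot 1 := by
    simp only [Polynomial.IsRoot, Polynomial.eval_sub, he, Polynomial.eval_mul, Polynomial.eval_C,
      Polynomial.eval_pow, Polynomial.eval_add, Polynomial.eval_X, hb]
    norm_num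
  obtain ⟨g, hg⟩ := Polynomial.dvd_iff_isRoot.2 hroot
  have hdeg : (f - e).degree ≤ n := by
    refine (Polynomial.degree_sub_le _ _).trans (max_le hf ((degree_C_mul_le_degree _ _).trans ?_))
    rw [Polynomial.degree_pow, Polynomial.degree_X_add_C]; simp
  have hgdeg : g.degree < n := by
    by_cases hg0 : g = 0
    · rw [hg0, Polynomial.degree_zero]; exact WithBot.bot_lt_coe n
    · rw [hg, Polynomial.degree_mul, Polynomial.degree_X_sub_C,
        Polynomial.degree_eq_natDegree hg0] at hdeg
      rw [Polynomial.degree_eq_natDegree hg0]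
      have : 1 + g.natDegree ≤ n := by exact_mod_cast hdeg
      exact_mod_cast (by omega : g.natDegree < n)
  have hfun : ∀ x : ℝ, (jacobiPoly (α + 1) β n).eval x * f.eval x =
      b * ((jacobiPoly (α + 1) β n).eval x * (1 + x) ^ n) -
        (1 - x) * ((jacobiPoly (α + 1) β n).eval x * g.eval x) := by
    intro x
    have hfx : f.eval x = b * (1 + x) ^ n + (x - 1) * g.eval x := by
      have := congrArg (Polynomial.eval x) (sub_eq_iff_eq_add'.1 hg)
      simpa [he, add_comm x 1] using this
    rw [hfx]; ring
  simp only [hfun]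
  rw [integral_sub, integral_const_mul, integral_jacobiPoly_succ_mul_one_add_pow hα hβ,
    integral_jacobiMeasure_one_sub_mul, integral_jacobiPoly_mul_eq_zero (by linarith) hβ hgdeg, hb]
  · field_simp
    ring
  · exact integrable_jacobiMeasure_of_continuous hα hβ (by fun_prop)
  · exact integrable_jacobiMeasure_of_continuous hα hβ (by fun_prop)

/-! ### Jacobi polynomials as a system with kernel polynomials, and the norm -/

theorem isOrthogonalSystem_jacobiPoly {α β : ℝ} (hα : -1 < α) (hβ : -1 < β) :
    IsOrthogonalSystem ⊤ (jacobiMeasure α β) (jacobiPoly α β) (jacobiNorm α β) where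
  moments n := integrable_jacobiMeasure_of_continuous hα hβ (by fun_prop)
  support := by
    rw [(infinite_support_jacobiMeasure hα hβ).encard_eq]
    exact le_top
  degree n _ := degree_jacobiPoly hα hβ n
  orthogonal m n _ _ := by
    rcases lt_trichotomy m n with hmn | rfl | hmn
    · simp only [mul_comm (Polynomial.eval _ (jacobiPoly α β m))]
      rw [if_neg hmn.ne, integral_jacobiPoly_mul_eq_zero hα hβ]
      rw [degree_jacobiPoly hα hβ]
      exact_mod_cast hmn
    · simp only [if_pos, jacobiNorm, sq]
    · rw [if_neg hmn.ne', integral_jacobiPoly_mul_eq_zero hα hβ]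
      rw [degree_jacobiPoly hα hβ]
      exact_mod_cast hmn

theorem jacobiPoly_succ_eval_eq_kernelPoly {α β : ℝ} (hα : -1 < α) (hβ : -1 < β) (n : ℕ) (x : ℝ) :
    (jacobiPoly (α + 1) β n).eval x =
      kernelPoly (jacobiPoly α β) (jacobiNorm α β) (jacobiConst α β) 1 n x :=
  (isOrthogonalSystem_jacobiPoly hα hβ).eval_eq_kernelPoly 1 _ le_top
    (degree_jacobiPoly_le (α + 1) β n) (fun _ hf => integral_jacobiPoly_succ_mul hα hβ hf) x

theorem jacobiConst_mul_jacobiPoly_succ_eval_one {α β : ℝ} (hα : -1 < α) (n : ℕ) :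
    jacobiConst α β n * (jacobiPoly (α + 1) β n).eval 1 =
      2 ^ (α + β + 1) / (α + 1) *
        (Real.Gamma (n + α + 2) * Real.Gamma (n + β + 1) /
          (Real.Gamma (n + α + β + 2) * n.factorial)) := by
  have hα0 : α + 1 ≠ 0 := by linarith
  have e := ascPochhammer_eval_mul_Gamma (x := α + 1 + 1) (by linarith) n
  rw [Real.Gamma_add_one hα0, show α + 1 + 1 + (n : ℝ) = n + α + 2 by ring] at e
  rw [jacobiPoly_eval_one, jacobiConst, ← e]
  field_simp

theorem mainTheorem4 :
    -- the general identity for kernel polynomials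
    (∀ (N : ℕ∞) (μ : Measure ℝ) (p : ℕ → Polynomial ℝ) (h : ℕ → ℝ),
      IsOrthogonalSystem N μ p h →
      ∀ (x₀ : ℝ) (c : ℕ → ℝ) (n : ℕ), (n : ℕ∞) ≤ N →
        Integrable (fun x => kernelPoly p h c x₀ n x ^ 2) μ ∧
        ∫ x, kernelPoly p h c x₀ n x ^ 2 ∂μ = c n * kernelPoly p h c x₀ n x₀) ∧
    -- the Jacobi case
    (∀ α β : ℝ, -1 < α → -1 < β →
      IsOrthogonalSystem ⊤ (jacobiMeasure α β) (jacobiPoly α β) (jacobiNorm α β) ∧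
      ∀ n : ℕ,
        (jacobiPoly α β n).eval 1 = (ascPochhammer ℝ n).eval (α + 1) / n.factorial ∧
        (∀ x : ℝ, (jacobiPoly (α + 1) β n).eval x =
          kernelPoly (jacobiPoly α β) (jacobiNorm α β) (jacobiConst α β) 1 n x) ∧
        IntervalIntegrable
          (fun x : ℝ => (jacobiPoly (α + 1) β n).eval x ^ 2 * (1 - x) ^ α * (1 + x) ^ β)
          volume (-1) 1 ∧
        ∫ x in (-1 : ℝ)..1, (jacobiPoly (α + 1) β n).eval x ^ 2 * (1 - x) ^ α * (1 + x) ^ β =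
          2 ^ (α + β + 1) / (α + 1) *
            (Real.Gamma (n + α + 2) * Real.Gamma (n + β + 1) /
              (Real.Gamma (n + α + β + 2) * n.factorial))) := by

  refine ⟨fun N μ p h H x₀ c n hn =>
    ⟨H.integrable_kernelPoly_sq x₀ c n, H.integral_kernelPoly_sq x₀ c hn⟩, fun α β hα hβ => ?_⟩
  have H := isOrthogonalSystem_jacobiPoly hα hβ
  refine ⟨H, fun n => ?_⟩
  have hq := jacobiPoly_succ_eval_eq_kernelPoly hα hβ n
  have hint := H.integrable_kernelPoly_sq 1 (jacobiConst α β) n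
  have hval := H.integral_kernelPoly_sq 1 (jacobiConst α β) (n := n) le_top
  simp only [← hq] at hint hval
  rw [integrable_jacobiMeasure_iff] at hint
  rw [integral_jacobiMeasure, jacobiConst_mul_jacobiPoly_succ_eval_one hα] at hval
  have hcomm : ∀ x : ℝ, (jacobiPoly (α + 1) β n).eval x ^ 2 * (1 - x) ^ α * (1 + x) ^ β =
      (1 - x) ^ α * (1 + x) ^ β * (jacobiPoly (α + 1) β n).eval x ^ 2 := fun x => by ring
  simp only [hcomm]
  exact ⟨jacobiPoly_eval_one α β n, hq, hint, hval⟩
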